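/- Let $d\ge 1$ and $N\ge 1$ be integers, write $x=(x_1,\dots,x_N)\in\mathbb R^{dN}$ with $x_j\in\mathbb R^d$, let $r_{ij}=|x_i-x_j|$ be the Euclidean distance, and let $\nabla_{x_j}$ denote the (weak) gradient with respect to $x_j$. Let $u\in H^1(\mathbb R^{dN})$ be a complex-valued function that is anti-symmetric, i.e. for all $i\ne j$ $$u(x_1,\dots,x_i,\dots,x_j,\dots,x_N)=-u(x_1,\dots,x_j,\dots,x_i,\dots,x_N)$$ for almost every $x$. Then $$\sum_{j=1}^N\int_{\mathbb R^{dN}}|\nabla_{x_j}u|^2\,dx\ \ge\ \frac{d^2}{N}\sum_{1\le i<j\le N}\int_{\mathbb R^{dN}}\frac{|u|^2}{r_{ij}^2}\,dx .$$ In particular, the integrals on the right-hand side are finite. -/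

import Mathlib

open MeasureTheory
open scoped ENNReal ContDiff

namespace ManyParticle

/-- The configuration space `ℝ^{dN}` of `N` particles in `ℝ^d`: the point `x` is
`(x 0, …, x (N - 1))` with `x i` in Euclidean `ℝ^d`. Its `volume` is the product of the Lebesgue
measures of the factors, that is, Lebesgue measure on `ℝ^{dN}`. -/
abbrev Config (d N : ℕ) : Type := Fin N → EuclideanSpace ℝ (Fin d)

/-- The unit vector of `ℝ^{dN}` in the direction of the `k`-th coordinate of the `j`-th particle. -/
noncomputable def dir {d N : ℕ} (j : Fin N) (k : Fin d) : Config d N :=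
  Pi.single j (EuclideanSpace.single k (1 : ℝ))

/-- `G j` is the weak (distributional) gradient `∇_{x_j} u` with respect to the `j`-th particle,
for every `j`: all functions are locally integrable and
`∫ u ∂φ/∂x_{j,k} = - ∫ (G j)_k φ` for all test functions `φ ∈ C_c^∞(ℝ^{dN})`. -/
structure HasWeakGradient {d N : ℕ} (u : Config d N → ℂ)
    (G : Fin N → Config d N → EuclideanSpace ℂ (Fin d)) : Prop where
  locallyIntegrable : LocallyIntegrable u volume
  locallyIntegrable_grad : ∀ j, LocallyIntegrable (G j) volume
  integral_eq : ∀ φ : Config d N → ℝ, ContDiff ℝ ∞ φ → HasCompactSupport φ →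
    ∀ (j : Fin N) (k : Fin d),
      ∫ x, (fderiv ℝ φ x (dir j k)) • u x = - ∫ x, φ x • (G j x) k

/-- `u ∈ H¹(ℝ^{dN})`: `u` is in `L²` and has a weak gradient in `L²`. -/
def MemH1 {d N : ℕ} (u : Config d N → ℂ) : Prop :=
  MemLp u 2 volume ∧
    ∃ G : Fin N → Config d N → EuclideanSpace ℂ (Fin d),
      HasWeakGradient u G ∧ ∀ j, MemLp (G j) 2 volume

/-- `u` is anti-symmetric: exchanging two different particles changes its sign (almost everywhere,
as elements of `H¹` are classes of functions up to null sets). -/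
def IsAntisymmetric {d N : ℕ} (u : Config d N → ℂ) : Prop :=
  ∀ i j : Fin N, i ≠ j → ∀ᵐ x : Config d N, u (fun l => x (Equiv.swap i j l)) = - u x

end ManyParticle

/-! ### The regularized ground-state field of the half-space Hardy inequality -/

namespace OddHardy

open Filter Topology

variable {E : Type*} [NormedAddCommGroup E] [NormedSpace ℝ E]

/-! For each pair `i < j`, anti-symmetry makes `u` odd in `y = x_i - x_j` with the centre of mass
and the other particles fixed. Odd functions satisfy a Hardy inequality in `y` with constant
`(d/2)²`, better than the usual `((d-2)/2)²`. The gradient in `y` is half of `∇_{x_i} - ∇_{x_j}`,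
which turns `(d/2)²` into `d²`, and `∑_{i<j} |a_i - a_j|² ≤ N ∑ |a_i|²` sums the pairs with the loss
of a factor `N`.

The odd Hardy inequality rests on `ψ = y_k |y|^{-d/2}`, for which `-Δψ = (d/2)² |y|⁻² ψ`. With `F =
-∇ log ψ` one has `div F - |F|² = (d/2)²/|y|²`, so expanding `0 ≤ ∫ |∇w + F w|²` and integrating by
parts gives the bound for every `w` vanishing on `y_k = 0`, in particular for `w` odd in the single
coordinate `y_k` (`hardy_of_odd_coord`). A function odd under `y ↦ -y` is an orthogonal sum of
pieces each odd in some coordinate, and both sides of the inequality are additive over this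
splitting (`hardy_of_odd`).

For `u` in `H¹`, cutoffs of mollifications approximate `u` almost everywhere without raising the
derivative norms by more than `o(1)` (`exists_approximation`). They need not be anti-symmetric. The
smooth inequality therefore bounds, for each pair, only the part odd under that exchange
(`hardy_odd_part`); these parts still converge to `u`, and Fatou's lemma concludes. -/

/-- Integrating by parts `∫ F ∂_v h = - ∫ (∂_v F) h` for a compactly supported `C¹` function `h`. -/
theorem integral_mul_lineDeriv_eq [FiniteDimensional ℝ E] [MeasurableSpace E] [BorelSpace E]
    (μ : Measure E) [μ.IsAddHaarMeasure] {F F' h : E → ℝ} {v : E}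
    (hF : Continuous F) (hF' : Continuous F')
    (hFF' : ∀ x, HasLineDerivAt ℝ F (F' x) x v) (hh : ContDiff ℝ 1 h) (hc : HasCompactSupport h) :
    ∫ x, F x * fderiv ℝ h x v ∂μ = - ∫ x, F' x * h x ∂μ := by
  have hcd : Continuous fun x => fderiv ℝ h x v :=
    (hh.continuous_fderiv one_ne_zero).clm_apply continuous_const
  have hcs : HasCompactSupport fun x => fderiv ℝ h x v := hc.fderiv_apply ℝ v
  refine integral_bilinear_hasLineDerivAt_right_eq_neg_left_of_integrable
    (B := ContinuousLinearMap.mul ℝ ℝ) (v := v) (μ := μ) ?_ ?_ ?_ (fun x _ => hFF' x)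
    (fun x _ => ((hh.differentiable one_ne_zero x).hasFDerivAt).hasLineDerivAt v)
  · exact (hF'.mul hh.continuous).integrable_of_hasCompactSupport hc.mul_left
  · exact (hF.mul hcd).integrable_of_hasCompactSupport hcs.mul_left
  · exact (hF.mul hh.continuous).integrable_of_hasCompactSupport hc.mul_left

section Field

variable {ι : Type*} [Fintype ι]

/-- The component `F l` of minus the logarithmic gradient of a regularization of the function
`y_k |y|^{-d/2}`, the ground state of the Hardy inequality in the half space. -/
noncomputable def field [DecidableEq ι] (y : ι → E →L[ℝ] ℝ) (k : ι) (ε δ : ℝ) (l : ι) (x : E) : ℝ :=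
  (Fintype.card ι : ℝ) / 2 * (y l x / (∑ m, y m x ^ 2 + ε)) -
    if l = k then y k x / (y k x ^ 2 + δ) else 0

/-- The derivative of `field y k ε δ l` in the `l`-th direction. -/
noncomputable def fieldDeriv [DecidableEq ι] (y : ι → E →L[ℝ] ℝ) (k : ι) (ε δ : ℝ) (l : ι) (x : E) : ℝ :=
  (Fintype.card ι : ℝ) / 2 *
      ((∑ m, y m x ^ 2 + ε - 2 * y l x ^ 2) / (∑ m, y m x ^ 2 + ε) ^ 2) -
    if l = k then (δ - y k x ^ 2) / (y k x ^ 2 + δ) ^ 2 else 0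

variable {y : ι → E →L[ℝ] ℝ} {ε δ : ℝ}

theorem sum_sq_add_pos (hε : 0 < ε) (x : E) : 0 < ∑ m, y m x ^ 2 + ε :=
  add_pos_of_nonneg_of_pos (Finset.sum_nonneg fun _ _ => sq_nonneg _) hε

theorem continuous_sum_sq : Continuous fun x => ∑ m, y m x ^ 2 := by fun_prop

variable [DecidableEq ι]

theorem continuous_field (k : ι) (hε : 0 < ε) (hδ : 0 < δ) (l : ι) :
    Continuous (field y k ε δ l) := by
  unfold field
  refine (continuous_const.mul (((y l).continuous).div₀ (continuous_sum_sq.add continuous_const)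
    fun x => (sum_sq_add_pos hε x).ne')).sub ?_
  split_ifs
  · exact ((y k).continuous).div₀ (by fun_prop) fun x => by positivity
  · exact continuous_const

theorem continuous_fieldDeriv (k : ι) (hε : 0 < ε) (hδ : 0 < δ) (l : ι) :
    Continuous (fieldDeriv y k ε δ l) := by
  unfold fieldDeriv
  refine (continuous_const.mul (Continuous.div₀ (by fun_prop) (by fun_prop)
    fun x => pow_ne_zero 2 (sum_sq_add_pos hε x).ne')).sub ?_
  split_ifs
  · exact Continuous.div₀ (by fun_prop) (by fun_prop) fun x => by positivity
  · exact continuous_const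

theorem hasLineDerivAt_field {D : ι → E} (hyD : ∀ k l, y k (D l) = if k = l then 1 else 0)
    (k : ι) (hε : 0 < ε) (hδ : 0 < δ) (l : ι) (x : E) :
    HasLineDerivAt ℝ (field y k ε δ l) (fieldDeriv y k ε δ l x) x (D l) := by
  have hy : ∀ m, HasDerivAt (fun t : ℝ => y m (x + t • D l)) (if m = l then 1 else 0) 0 := by
    intro m
    have : (fun t : ℝ => y m (x + t • D l)) = fun t => y m x + t * (if m = l then 1 else 0) := by
      ext t; simp [hyD]
    rw [this]
    simpa using ((hasDerivAt_id (0 : ℝ)).mul_const (if m = l then (1 : ℝ) else 0)).const_add (y m x)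
  have hq : HasDerivAt (fun t : ℝ => ∑ m, y m (x + t • D l) ^ 2 + ε) (2 * y l x) 0 := by
    have := (HasDerivAt.fun_sum (u := Finset.univ) fun m _ => (hy m).fun_pow 2).add_const ε
    simpa using this
  have h1 := ((hy l).fun_div hq (by simpa using (sum_sq_add_pos hε x).ne')).const_mul
    ((Fintype.card ι : ℝ) / 2)
  have hq0 := (sum_sq_add_pos (y := y) hε x).ne'
  unfold HasLineDerivAt field fieldDeriv
  split_ifs with hl
  · subst hl
    have hp : HasDerivAt (fun t : ℝ => y l (x + t • D l) ^ 2 + δ) (2 * y l x) 0 := by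
      simpa using ((hy l).fun_pow 2).add_const δ
    have hp0 : y l x ^ 2 + δ ≠ 0 := by positivity
    have h2 := (hy l).fun_div hp (by simpa using hp0)
    refine (h1.fun_sub h2).congr_deriv ?_
    simp only [zero_smul, add_zero, if_true]
    ring
  · refine (h1.sub_const 0).congr_deriv ?_
    simp only [zero_smul, add_zero, if_true, sub_zero]
    ring

/-- The regularized form of `div F - |F|² = (d/2)² / |y|²`. -/
theorem le_sum_fieldDeriv_sub_sq (k : ι) (hε : 0 < ε) (hδ : 0 < δ) (x : E) :
    ((Fintype.card ι : ℝ) / 2) ^ 2 / (∑ m, y m x ^ 2 + ε) -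
        ((Fintype.card ι : ℝ) / ε * (δ / (y k x ^ 2 + δ)) + δ / (y k x ^ 2 + δ) ^ 2) ≤
      ∑ l, (fieldDeriv y k ε δ l x - field y k ε δ l x ^ 2) := by
  set n : ℝ := (Fintype.card ι : ℝ) with hn
  set S : ℝ := ∑ m, y m x ^ 2 with hS
  have hS0 : 0 ≤ S := Finset.sum_nonneg fun _ _ => sq_nonneg _
  set s := y k x with hs
  have hn0 : 0 ≤ n := by positivity
  have hq : 0 < S + ε := by positivity
  have hp : 0 < s ^ 2 + δ := by positivity
  -- Exact value of the regularized `div F - |F|²`. The `y_k`-part of `F` alone contributes only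
  -- `-δ/(s²+δ)²`; the cross term, with `s²/(s²+δ) = 1 - δ/(s²+δ)`, gives the other error.
  have key : ∑ l, (fieldDeriv y k ε δ l x - field y k ε δ l x ^ 2) =
      n ^ 2 / 2 / (S + ε) - (n + n ^ 2 / 4) * (S / (S + ε) ^ 2) + n * (s ^ 2 / ((S + ε) * (s ^ 2 + δ)))
        - δ / (s ^ 2 + δ) ^ 2 := by
    have h1 : ∀ l, fieldDeriv y k ε δ l x - field y k ε δ l x ^ 2 =
        (n / 2 / (S + ε) - (n + n ^ 2 / 4) / (S + ε) ^ 2 * y l x ^ 2) +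
        (if l = k then n * (s ^ 2 / ((S + ε) * (s ^ 2 + δ))) - δ / (s ^ 2 + δ) ^ 2 else 0) := by
      intro l
      unfold field fieldDeriv
      rw [← hS, ← hn]
      split_ifs with hl
      · subst hl
        field_simp
        ring
      · field_simp
        ring
    rw [Finset.sum_congr rfl fun l _ => h1 l, Finset.sum_add_distrib, Finset.sum_sub_distrib,
      ← Finset.mul_sum, ← hS]
    simp only [Finset.sum_const, Finset.card_univ, nsmul_eq_mul, ← hn, Finset.sum_ite_eq',
      Finset.mem_univ, if_true]
    ring
  rw [key]
  have h2 : S / (S + ε) ^ 2 ≤ 1 / (S + ε) := by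
    rw [div_le_div_iff₀ (by positivity) hq]
    nlinarith
  have h3 : s ^ 2 / ((S + ε) * (s ^ 2 + δ)) = 1 / (S + ε) - 1 / (S + ε) * (δ / (s ^ 2 + δ)) := by
    field_simp
    ring
  have h4 : 1 / (S + ε) ≤ 1 / ε := one_div_le_one_div_of_le hε (by linarith)
  have h5 : n * (1 / (S + ε) * (δ / (s ^ 2 + δ))) ≤ n / ε * (δ / (s ^ 2 + δ)) := by
    rw [← mul_assoc]
    have := mul_le_mul_of_nonneg_left h4 hn0
    rw [mul_one_div] at this
    rw [mul_one_div] at this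
    rw [mul_one_div]
    gcongr
  have h6 := mul_le_mul_of_nonneg_left h2 (by positivity : 0 ≤ n + n ^ 2 / 4)
  rw [h3]
  -- The constant: `n²/2 - (n + n²/4) + n = (n/2)²`. The last `n`, from the cross term, is the gain
  -- due to oddness.
  have h7 : (n / 2) ^ 2 / (S + ε) = n ^ 2 / 2 / (S + ε) - (n + n ^ 2 / 4) * (1 / (S + ε)) +
    n * (1 / (S + ε)) := by field_simp; ring
  rw [h7]
  linarith

end Field

end OddHardy

/-! ### Hardy inequality for functions odd in one coordinate -/

namespace OddHardy

open Filter Topology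

theorem hasCompactSupport_norm_sq {X : Type*} [TopologicalSpace X] {f : X → ℂ}
    (hc : HasCompactSupport f) : HasCompactSupport fun x => ‖f x‖ ^ 2 :=
  hc.mono' fun x hx => subset_tsupport f fun h0 => hx (by simp [h0])

theorem integrable_norm_sq {X : Type*} [TopologicalSpace X] [MeasurableSpace X]
    [OpensMeasurableSpace X] (μ : Measure X) [IsFiniteMeasureOnCompacts μ] {f : X → ℂ}
    (hf : Continuous f) (hc : HasCompactSupport f) : Integrable (fun x => ‖f x‖ ^ 2) μ :=
  (hf.norm.pow 2).integrable_of_hasCompactSupport (hasCompactSupport_norm_sq hc)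

variable {E : Type*} [NormedAddCommGroup E] [NormedSpace ℝ E] [FiniteDimensional ℝ E]
  [MeasurableSpace E] [BorelSpace E] (μ : Measure E) [μ.IsAddHaarMeasure]
  {ι : Type*} [Fintype ι] [DecidableEq ι] {y : ι → E →L[ℝ] ℝ} {D : ι → E} {w : E → ℂ}

/-- Integrate `0 ≤ |∂_l w + F_l w|² = |∂_l w|² + F_l ∂_l|w|² + F_l²|w|²`, move the derivative onto
`F_l`, sum over `l`, and insert the lower bound for `div F - |F|²`. No oddness enters while `ε, δ >
0`. -/
theorem integral_mul_le_integral_sum_sq (hyD : ∀ k l, y k (D l) = if k = l then 1 else 0)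
    (hw : ContDiff ℝ 1 w) (hc : HasCompactSupport w) (k : ι) {ε δ : ℝ} (hε : 0 < ε) (hδ : 0 < δ) :
    ∫ x, ‖w x‖ ^ 2 * (((Fintype.card ι : ℝ) / 2) ^ 2 / (∑ m, y m x ^ 2 + ε) -
        ((Fintype.card ι : ℝ) / ε * (δ / (y k x ^ 2 + δ)) + δ / (y k x ^ 2 + δ) ^ 2)) ∂μ ≤
      ∫ x, ∑ l, ‖fderiv ℝ w x (D l)‖ ^ 2 ∂μ := by
  set h : E → ℝ := fun x => ‖w x‖ ^ 2 with hh
  have hh1 : ContDiff ℝ 1 h := hw.norm_sq ℂ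
  have hhc : HasCompactSupport h := hasCompactSupport_norm_sq hc
  have hdw : ∀ v, Continuous fun x => fderiv ℝ w x v := fun v =>
    (hw.continuous_fderiv one_ne_zero).clm_apply continuous_const
  have hdh : ∀ v, Continuous fun x => fderiv ℝ h x v := fun v =>
    (hh1.continuous_fderiv one_ne_zero).clm_apply continuous_const
  have hi1 : ∀ l, Integrable (fun x => ‖fderiv ℝ w x (D l)‖ ^ 2) μ := fun l =>
    integrable_norm_sq μ (hdw (D l)) (hc.fderiv_apply ℝ (D l))
  have hi2 : ∀ l, Integrable (fun x => field y k ε δ l x * fderiv ℝ h x (D l)) μ := fun l =>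
    ((continuous_field k hε hδ l).mul (hdh _)).integrable_of_hasCompactSupport
      (hhc.fderiv_apply ℝ (D l)).mul_left
  have hi3 : ∀ l, Integrable (fun x => field y k ε δ l x ^ 2 * h x) μ := fun l =>
    (((continuous_field k hε hδ l).pow 2).mul hh1.continuous).integrable_of_hasCompactSupport
      hhc.mul_left
  have hi4 : ∀ l, Integrable (fun x => fieldDeriv y k ε δ l x * h x) μ := fun l =>
    ((continuous_fieldDeriv k hε hδ l).mul hh1.continuous).integrable_of_hasCompactSupport
      hhc.mul_left
  have hl : ∀ l, ∫ x, (fieldDeriv y k ε δ l x - field y k ε δ l x ^ 2) * h x ∂μ ≤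
      ∫ x, ‖fderiv ℝ w x (D l)‖ ^ 2 ∂μ := by
    intro l
    have hpt : ∀ x, 0 ≤ ‖fderiv ℝ w x (D l)‖ ^ 2 + field y k ε δ l x * fderiv ℝ h x (D l) +
        field y k ε δ l x ^ 2 * h x := by
      intro x
      have hd : fderiv ℝ h x (D l) = 2 * inner ℝ (w x) (fderiv ℝ w x (D l)) := by
        have := ((hw.differentiable one_ne_zero x).hasFDerivAt.norm_sq).fderiv
        rw [hh, this]
        simp
        ring
      have := sq_nonneg ‖fderiv ℝ w x (D l) + field y k ε δ l x • w x‖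
      rw [norm_add_sq_real, inner_smul_right, norm_smul, mul_pow, Real.norm_eq_abs, sq_abs,
        real_inner_comm] at this
      rw [hd]
      linarith
    have h0 := integral_nonneg_of_ae (μ := μ) (Eventually.of_forall hpt)
    have h12 : Integrable (fun x => ‖fderiv ℝ w x (D l)‖ ^ 2 +
        field y k ε δ l x * fderiv ℝ h x (D l)) μ := (hi1 l).add (hi2 l)
    rw [integral_add h12 (hi3 l), integral_add (hi1 l) (hi2 l),
      integral_mul_lineDeriv_eq μ (continuous_field k hε hδ l) (continuous_fieldDeriv k hε hδ l)
        (hasLineDerivAt_field hyD k hε hδ l) hh1 hhc] at h0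
    simp only [sub_mul]
    rw [integral_sub (hi4 l) (hi3 l)]
    linarith
  have hi5 : ∀ l, Integrable (fun x => (fieldDeriv y k ε δ l x - field y k ε δ l x ^ 2) * h x) μ :=
    fun l => ((hi4 l).sub (hi3 l)).congr (Eventually.of_forall fun x => by simp [sub_mul])
  rw [integral_finsetSum _ fun l _ => hi1 l]
  refine le_trans ?_ (Finset.sum_le_sum fun l _ => hl l)
  rw [← integral_finsetSum _ fun l _ => hi5 l]
  refine integral_mono ?_ (integrable_finsetSum _ fun l _ => hi5 l) fun x => ?_
  · refine (hh1.continuous.mul ?_).integrable_of_hasCompactSupport hhc.mul_right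
    have hp : ∀ x, y k x ^ 2 + δ ≠ 0 := fun x => by positivity
    refine (continuous_const.div₀ (by fun_prop) fun x => (sum_sq_add_pos hε x).ne').sub
      ((continuous_const.mul (continuous_const.div₀ (by fun_prop) hp)).add
        (continuous_const.div₀ (by fun_prop) fun x => pow_ne_zero 2 (hp x)))
  · simp only
    rw [← Finset.sum_mul, mul_comm]
    exact mul_le_mul_of_nonneg_right (le_sum_fieldDeriv_sub_sq k hε hδ x) (sq_nonneg _)

/-- Dominated convergence as `δ = 1/(n+1) → 0`. The singular factor `δ/(y_k²+δ)²` is controlled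
because `|w|² ≤ C² y_k²` and `y_k² δ ≤ (y_k²+δ)²`. -/
theorem tendsto_integral_error {E ι : Type*} [NormedAddCommGroup E] [NormedSpace ℝ E]
    [MeasurableSpace E] [BorelSpace E] (μ : Measure E) [IsFiniteMeasureOnCompacts μ]
    {y : ι → E →L[ℝ] ℝ} {w : E → ℂ} (hw : ContDiff ℝ 1 w) (hc : HasCompactSupport w) {k : ι} {C : ℝ}
    (hC : ∀ x, ‖w x‖ ≤ C * |y k x|) {a : ℝ} (ha : 0 ≤ a) :
    Tendsto (fun n : ℕ => ∫ x, ‖w x‖ ^ 2 * (a * ((1 / ((n : ℝ) + 1)) / (y k x ^ 2 + 1 / ((n : ℝ) + 1)))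
      + (1 / ((n : ℝ) + 1)) / (y k x ^ 2 + 1 / ((n : ℝ) + 1)) ^ 2) ∂μ) atTop (𝓝 0) := by
  have hδ : ∀ n : ℕ, 0 < 1 / ((n : ℝ) + 1) := fun n => by positivity
  have hsq : ∀ x, ‖w x‖ ^ 2 ≤ C ^ 2 * y k x ^ 2 := fun x => by
    rw [← sq_abs (y k x), ← mul_pow]
    exact pow_le_pow_left₀ (norm_nonneg _) (hC x) 2
  have hcs : HasCompactSupport (Set.indicator (tsupport w) fun _ => (1 : ℝ)) :=
    HasCompactSupport.intro hc fun x hx => by simp [hx]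
  rw [← integral_zero E ℝ (μ := μ)]
  refine tendsto_integral_of_dominated_convergence
    ((tsupport w).indicator fun x => a * ‖w x‖ ^ 2 + C ^ 2) (fun n => ?_) ?_ (fun n => ?_) ?_
  · refine Continuous.aestronglyMeasurable (Continuous.mul (by have := hw.continuous; fun_prop) ?_)
    have hp : ∀ x, y k x ^ 2 + 1 / ((n : ℝ) + 1) ≠ 0 := fun x => by positivity
    exact (continuous_const.mul (continuous_const.div₀ (by fun_prop) hp)).add
        (continuous_const.div₀ (by fun_prop) fun x => pow_ne_zero 2 (hp x))
  · rw [integrable_indicator_iff (isClosed_tsupport w).measurableSet]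
    refine ContinuousOn.integrableOn_compact hc ?_
    have := hw.continuous
    fun_prop
  · refine Eventually.of_forall fun x => ?_
    have hδn := hδ n
    clear hδ
    generalize 1 / ((n : ℝ) + 1) = δ at hδn ⊢
    by_cases hx : x ∈ tsupport w
    · rw [Set.indicator_of_mem hx, Real.norm_of_nonneg (by positivity), mul_add]
      have h1 : δ / (y k x ^ 2 + δ) ≤ 1 := by
        rw [div_le_one (by positivity)]
        nlinarith [sq_nonneg (y k x)]
      refine add_le_add ?_ ?_
      · rw [mul_comm, mul_assoc]
        refine mul_le_mul_of_nonneg_left ?_ ha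
        nlinarith [sq_nonneg ‖w x‖]
      · refine (mul_le_mul_of_nonneg_right (hsq x) (by positivity)).trans ?_
        have h2 : y k x ^ 2 * (δ / (y k x ^ 2 + δ) ^ 2) ≤ 1 := by
          rw [mul_div_assoc', div_le_one (by positivity)]
          nlinarith [sq_nonneg (y k x), mul_nonneg (sq_nonneg (y k x)) hδn.le, sq_nonneg (y k x ^ 2),
            sq_nonneg δ]
        nlinarith [sq_nonneg C]
    · rw [Set.indicator_of_notMem hx, image_eq_zero_of_notMem_tsupport hx]
      simp
  · refine Eventually.of_forall fun x => ?_
    by_cases hx : y k x = 0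
    · have : w x = 0 := by simpa [hx] using hC x
      simp [this]
    · have hlim : Tendsto (fun δ : ℝ => ‖w x‖ ^ 2 * (a * (δ / (y k x ^ 2 + δ)) +
          δ / (y k x ^ 2 + δ) ^ 2)) (𝓝 0) (𝓝 (‖w x‖ ^ 2 * (a * (0 / (y k x ^ 2 + 0)) +
          0 / (y k x ^ 2 + 0) ^ 2))) := by
        refine ContinuousAt.tendsto (f := fun δ : ℝ => ‖w x‖ ^ 2 * (a * (δ / (y k x ^ 2 + δ)) +
          δ / (y k x ^ 2 + δ) ^ 2)) ?_
        have h0 : y k x ^ 2 + 0 ≠ 0 := by simpa using hx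
        have h1 : (y k x ^ 2 + 0) ^ 2 ≠ 0 := pow_ne_zero 2 h0
        fun_prop (disch := assumption)
      have := hlim.comp tendsto_one_div_add_atTop_nhds_zero_nat
      simpa [Function.comp_def] using this

/-- **Hardy inequality** with the half space constant, for functions that are odd with respect to
one coordinate. -/
theorem hardy_of_odd_coord (hyD : ∀ k l, y k (D l) = if k = l then 1 else 0)
    (hw : ContDiff ℝ 1 w) (hc : HasCompactSupport w) (k : ι)
    (hodd : ∀ x, w (x - (2 * y k x) • D k) = - w x) :
    ENNReal.ofReal (((Fintype.card ι : ℝ) / 2) ^ 2) *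
        ∫⁻ x, ‖w x‖ₑ ^ 2 / ENNReal.ofReal (∑ m, y m x ^ 2) ∂μ ≤
      ∫⁻ x, ∑ l, ‖fderiv ℝ w x (D l)‖ₑ ^ 2 ∂μ := by
  obtain ⟨K, hK⟩ := hw.lipschitzWith_of_hasCompactSupport hc one_ne_zero
  -- Compare `w` at `x` and at its mirror image, a distance `2|y_k|‖D k‖` away: the difference of
  -- values is `2 w x`.
  have hC : ∀ x, ‖w x‖ ≤ (K * ‖D k‖) * |y k x| := by
    intro x
    have h1 := hK.norm_sub_le x (x - (2 * y k x) • D k)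
    rw [hodd, sub_neg_eq_add, sub_sub_cancel, norm_smul, norm_mul, ← two_mul, norm_mul,
      Real.norm_eq_abs (y k x)] at h1
    norm_num at h1
    linarith
  have hcw := hw.continuous
  have hi1 : ∀ l, Integrable (fun x => ‖fderiv ℝ w x (D l)‖ ^ 2) μ := fun l =>
    integrable_norm_sq μ ((hw.continuous_fderiv one_ne_zero).clm_apply continuous_const)
      (hc.fderiv_apply ℝ (D l))
  have hhc : HasCompactSupport fun x => ‖w x‖ ^ 2 :=
    hasCompactSupport_norm_sq hc
  set c : ℝ := ((Fintype.card ι : ℝ) / 2) ^ 2 with hcdef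
  have hc0 : 0 ≤ c := by positivity
  have hint : ∀ ε : ℝ, 0 < ε → Integrable (fun x => ‖w x‖ ^ 2 * (c / (∑ m, y m x ^ 2 + ε))) μ :=
    fun ε hε => ((hcw.norm.pow 2).mul (continuous_const.div₀ (by fun_prop)
      fun x => (sum_sq_add_pos hε x).ne')).integrable_of_hasCompactSupport hhc.mul_right
  have hreal : ∀ ε : ℝ, 0 < ε → ∫ x, ‖w x‖ ^ 2 * (c / (∑ m, y m x ^ 2 + ε)) ∂μ ≤
      ∫ x, ∑ l, ‖fderiv ℝ w x (D l)‖ ^ 2 ∂μ := by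
    intro ε hε
    have hlim := (tendsto_integral_error μ hw hc hC
      (a := (Fintype.card ι : ℝ) / ε) (by positivity)).const_sub
      (∫ x, ‖w x‖ ^ 2 * (c / (∑ m, y m x ^ 2 + ε)) ∂μ)
    rw [sub_zero] at hlim
    refine le_of_tendsto hlim (Eventually.of_forall fun n => ?_)
    have hδ : 0 < 1 / ((n : ℝ) + 1) := by positivity
    have := integral_mul_le_integral_sum_sq μ hyD hw hc k hε hδ
    refine le_trans (le_of_eq ?_) this
    have hp : ∀ x, y k x ^ 2 + 1 / ((n : ℝ) + 1) ≠ 0 := fun x => by positivity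
    rw [← integral_sub (hint ε hε)]
    · simp only [← mul_sub, ← hcdef]
    · refine ((hcw.norm.pow 2).mul ?_).integrable_of_hasCompactSupport hhc.mul_right
      exact (continuous_const.mul (continuous_const.div₀ (by fun_prop) hp)).add
        (continuous_const.div₀ (by fun_prop) fun x => pow_ne_zero 2 (hp x))
  have hR : ∫⁻ x, ∑ l, ‖fderiv ℝ w x (D l)‖ₑ ^ 2 ∂μ =
      ENNReal.ofReal (∫ x, ∑ l, ‖fderiv ℝ w x (D l)‖ ^ 2 ∂μ) := by
    rw [ofReal_integral_eq_lintegral_ofReal (integrable_finsetSum _ fun l _ => hi1 l)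
      (Eventually.of_forall fun x => Finset.sum_nonneg fun _ _ => sq_nonneg _)]
    refine lintegral_congr fun x => ?_
    rw [ENNReal.ofReal_sum_of_nonneg fun _ _ => sq_nonneg _]
    simp [ENNReal.ofReal_pow]
  have hcS : Continuous fun x => ∑ m, y m x ^ 2 := continuous_sum_sq
  rw [← lintegral_const_mul _ (by
    exact (hcw.enorm.measurable.pow_const 2).div hcS.measurable.ennreal_ofReal)]
  -- With `δ` gone, `ε → 0` by Fatou. Where `y = 0` also `w = 0`, and `0 / 0 = 0` in `ℝ≥0∞`.
  have hpt : ∀ x, ENNReal.ofReal c * (‖w x‖ₑ ^ 2 / ENNReal.ofReal (∑ m, y m x ^ 2)) ≤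
      liminf (fun n : ℕ => ENNReal.ofReal (‖w x‖ ^ 2 * (c / (∑ m, y m x ^ 2 + 1 / ((n : ℝ) + 1)))))
        atTop := by
    intro x
    have hS : 0 ≤ ∑ m, y m x ^ 2 := Finset.sum_nonneg fun _ _ => sq_nonneg _
    rcases hS.eq_or_lt with h0 | h0
    · have : y k x = 0 := by
        have := (Finset.sum_eq_zero_iff_of_nonneg fun _ _ => sq_nonneg _).1 h0.symm k
          (Finset.mem_univ k)
        simpa using this
      have : w x = 0 := by simpa [this] using hC x
      simp [this]
    · have hlim : Tendsto (fun n : ℕ => ENNReal.ofReal (‖w x‖ ^ 2 *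
          (c / (∑ m, y m x ^ 2 + 1 / ((n : ℝ) + 1))))) atTop
          (𝓝 (ENNReal.ofReal (‖w x‖ ^ 2 * (c / (∑ m, y m x ^ 2 + 0))))) := by
        refine ENNReal.tendsto_ofReal (Tendsto.const_mul _ (Tendsto.div tendsto_const_nhds
          (tendsto_one_div_add_atTop_nhds_zero_nat.const_add _) ?_))
        simpa using h0.ne'
      rw [hlim.liminf_eq, add_zero, mul_div_left_comm, ENNReal.ofReal_mul hc0,
        ENNReal.ofReal_div_of_pos h0, ENNReal.ofReal_pow (norm_nonneg _), ofReal_norm]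
  refine (lintegral_mono hpt).trans ((lintegral_liminf_le fun n => ?_).trans ?_)
  · refine (Continuous.measurable ?_).ennreal_ofReal
    exact (hcw.norm.pow 2).mul (continuous_const.div₀ (by fun_prop)
      fun x => (sum_sq_add_pos (by positivity) x).ne')
  · rw [hR]
    refine liminf_le_of_le (by isBoundedDefault) fun b hb => ?_
    obtain ⟨n, hn⟩ := hb.exists
    refine hn.trans ?_
    have hε : 0 < 1 / ((n : ℝ) + 1) := by positivity
    rw [← ofReal_integral_eq_lintegral_ofReal (hint _ hε) (Eventually.of_forall fun x => by
      have := sum_sq_add_pos (y := y) hε x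
      simp only [Pi.zero_apply]
      positivity)]
    exact ENNReal.ofReal_le_ofReal (hreal _ hε)

end OddHardy

/-! ### Reflections and parallelogram identities -/

namespace OddHardy

open Filter Topology

section Parallelogram

theorem enorm_half_add_sq_add_enorm_half_sub_sq (a b : ℂ) :
    ‖(a + b) / 2‖ₑ ^ 2 + ‖(a - b) / 2‖ₑ ^ 2 = 2⁻¹ * (‖a‖ₑ ^ 2 + ‖b‖ₑ ^ 2) := by
  have h : ‖(a + b) / 2‖ ^ 2 + ‖(a - b) / 2‖ ^ 2 = 2⁻¹ * (‖a‖ ^ 2 + ‖b‖ ^ 2) := by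
    have := parallelogram_law_with_norm ℝ a b
    rw [norm_div, norm_div]
    norm_num
    nlinarith
  have h2 := congrArg ENNReal.ofReal h
  rw [ENNReal.ofReal_add (by positivity) (by positivity), ENNReal.ofReal_mul (by positivity),
    ENNReal.ofReal_add (by positivity) (by positivity), ENNReal.ofReal_inv_of_pos (by norm_num)] at h2
  simpa only [ENNReal.ofReal_pow (norm_nonneg _), ofReal_norm, ENNReal.ofReal_ofNat] using h2

/-- Orthogonality of even and odd parts in a form usable in `ℝ≥0∞`. Only `|c| = |a ∘ T|` is asked,
because a derivative along a reflected direction may change sign. -/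
theorem lintegral_parallelogram {X : Type*} [MeasurableSpace X] {μ : Measure X} {T : X → X}
    (hT : MeasurePreserving T μ μ) {a b c : X → ℂ} {ρ : X → ℝ≥0∞} (ha : Measurable a)
    (hb : Measurable b) (hρ : Measurable ρ) (hc : ∀ x, ‖c x‖ₑ = ‖a (T x)‖ₑ)
    (hb' : ∀ x, b x = (a x + c x) / 2) (hρT : ∀ x, ρ (T x) = ρ x) :
    ∫⁻ x, ‖b x‖ₑ ^ 2 * ρ x ∂μ + ∫⁻ x, ‖(a x - c x) / 2‖ₑ ^ 2 * ρ x ∂μ =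
      ∫⁻ x, ‖a x‖ₑ ^ 2 * ρ x ∂μ := by
  have hm : Measurable fun x => ‖a x‖ₑ ^ 2 * ρ x := (ha.enorm.pow_const 2).mul hρ
  have h1 : ∫⁻ x, ‖c x‖ₑ ^ 2 * ρ x ∂μ = ∫⁻ x, ‖a x‖ₑ ^ 2 * ρ x ∂μ := by
    rw [← hT.lintegral_comp hm]
    simp only [hc, hρT]
  have hm' : Measurable fun x => ‖b x‖ₑ ^ 2 * ρ x := (hb.enorm.pow_const 2).mul hρ
  rw [← lintegral_add_left hm']
  simp only [← add_mul, hb', enorm_half_add_sq_add_enorm_half_sub_sq]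
  simp only [mul_assoc, add_mul]
  rw [lintegral_const_mul' _ _ (by simp), lintegral_add_left hm, h1, ← two_mul, ← mul_assoc,
    ENNReal.inv_mul_cancel (by simp) (by simp), one_mul]

end Parallelogram

variable {E : Type*} [NormedAddCommGroup E] [NormedSpace ℝ E]

theorem measurePreserving_of_involutive [FiniteDimensional ℝ E] [MeasurableSpace E] [BorelSpace E]
    (μ : Measure E) [μ.IsAddHaarMeasure] (T : E →L[ℝ] E) (hT : ∀ x, T (T x) = x) :
    MeasurePreserving T μ μ := by
  have h1 : (T : E →ₗ[ℝ] E) ∘ₗ (T : E →ₗ[ℝ] E) = LinearMap.id := LinearMap.ext hT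
  have h2 : LinearMap.det (T : E →ₗ[ℝ] E) * LinearMap.det (T : E →ₗ[ℝ] E) = 1 := by
    rw [← LinearMap.det_comp, h1, LinearMap.det_id]
  have h3 : |LinearMap.det (T : E →ₗ[ℝ] E)| = 1 := by
    rcases mul_self_eq_one_iff.1 h2 with h | h <;> simp [h]
  refine ⟨T.continuous.measurable, ?_⟩
  have := Measure.map_linearMap_addHaar_eq_smul_addHaar μ (f := (T : E →ₗ[ℝ] E))
    (left_ne_zero_of_mul_eq_one h2)
  rw [abs_inv, h3] at this
  simpa using this

theorem fderiv_comp_clm_apply {w : E → ℂ} (hw : ContDiff ℝ 1 w) (T : E →L[ℝ] E) (x v : E) :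
    fderiv ℝ (fun x => w (T x)) x v = fderiv ℝ w (T x) (T v) := by
  have h := ((hw.differentiable one_ne_zero (T x)).hasFDerivAt).comp x T.hasFDerivAt
  have := h.fderiv
  simp only [Function.comp_def] at this
  rw [this]
  rfl

theorem hasCompactSupport_comp_of_involutive {w : E → ℂ} (hc : HasCompactSupport w) {T : E →L[ℝ] E}
    (hT : ∀ x, T (T x) = x) : HasCompactSupport fun x => w (T x) :=
  hc.comp_homeomorph ⟨⟨T, T, hT, hT⟩, T.continuous, T.continuous⟩

section Reflect

variable {ι : Type*} (y : ι → E →L[ℝ] ℝ) (D : ι → E)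

/-- The linear map that changes the sign of the coordinates `y k`, `k ∈ s`. -/
noncomputable def reflect (s : Finset ι) : E →L[ℝ] E :=
  ContinuousLinearMap.id ℝ E - ∑ k ∈ s, (2 • y k).smulRight (D k)

theorem reflect_apply (s : Finset ι) (x : E) :
    reflect y D s x = x - ∑ k ∈ s, (2 * y k x) • D k := by
  simp [reflect, two_mul, two_smul]

variable {y D} [DecidableEq ι]

theorem coord_reflect (hyD : ∀ k l, y k (D l) = if k = l then 1 else 0)
    (s : Finset ι) (k : ι) (x : E) :
    y k (reflect y D s x) = if k ∈ s then - y k x else y k x := by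
  rw [reflect_apply]
  simp only [map_sub, map_sum, map_smul, hyD, smul_eq_mul, mul_ite, mul_one, mul_zero,
    Finset.sum_ite_eq]
  split_ifs <;> ring

theorem coord_reflect_sq (hyD : ∀ k l, y k (D l) = if k = l then 1 else 0)
    (s : Finset ι) (k : ι) (x : E) :
    y k (reflect y D s x) ^ 2 = y k x ^ 2 := by
  rw [coord_reflect hyD]
  split_ifs <;> ring

theorem reflect_reflect (hyD : ∀ k l, y k (D l) = if k = l then 1 else 0)
    (s : Finset ι) (x : E) : reflect y D s (reflect y D s x) = x := by
  have h : ∑ k ∈ s, (2 * y k (reflect y D s x)) • D k = - ∑ k ∈ s, (2 * y k x) • D k := by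
    rw [← Finset.sum_neg_distrib]
    refine Finset.sum_congr rfl fun k hk => ?_
    rw [coord_reflect hyD, if_pos hk, mul_neg, neg_smul]
  rw [reflect_apply _ _ _ (reflect y D s x), h, reflect_apply]
  abel

theorem reflect_dir (hyD : ∀ k l, y k (D l) = if k = l then 1 else 0)
    (s : Finset ι) (l : ι) :
    reflect y D s (D l) = if l ∈ s then - D l else D l := by
  rw [reflect_apply]
  simp only [hyD, mul_ite, mul_one, mul_zero, ite_smul, zero_smul, Finset.sum_ite_eq']
  split_ifs
  · rw [two_smul]; abel
  · simp

theorem reflect_insert (hyD : ∀ k l, y k (D l) = if k = l then 1 else 0)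
    {k : ι} {s : Finset ι} (hk : k ∉ s) (x : E) :
    reflect y D (insert k s) x = reflect y D {k} (reflect y D s x) := by
  rw [reflect_apply _ _ {k}, Finset.sum_singleton, coord_reflect hyD, if_neg hk, reflect_apply,
    reflect_apply, Finset.sum_insert hk]
  abel

theorem reflect_insert' (hyD : ∀ k l, y k (D l) = if k = l then 1 else 0)
    {k : ι} {s : Finset ι} (hk : k ∉ s) (x : E) :
    reflect y D (insert k s) x = reflect y D s (reflect y D {k} x) := by
  rw [reflect_apply _ _ s, reflect_apply, reflect_apply, Finset.sum_insert hk,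
    Finset.sum_singleton, ← sub_sub]
  congr 1
  refine Finset.sum_congr rfl fun l hl => ?_
  have := coord_reflect hyD {k} l x
  rw [if_neg (by rw [Finset.mem_singleton]; rintro rfl; exact hk hl), reflect_apply,
    Finset.sum_singleton] at this
  rw [this]

end Reflect

/-! ### Hardy inequality for functions odd under `y ↦ -y` -/

section Hardy

variable [FiniteDimensional ℝ E] [MeasurableSpace E] [BorelSpace E] (μ : Measure E)
  {ι : Type*} [Fintype ι] (y : ι → E →L[ℝ] ℝ) (D : ι → E)

/-- The integral of `∑ l, |∂_{D l} w|²`. -/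
noncomputable def energy (w : E → ℂ) : ℝ≥0∞ :=
  ∫⁻ x, ∑ l, ‖fderiv ℝ w x (D l)‖ₑ ^ 2 ∂μ

/-- The integral of `|w|² / |y|²`. -/
noncomputable def hardyTerm (w : E → ℂ) : ℝ≥0∞ :=
  ∫⁻ x, ‖w x‖ₑ ^ 2 / ENNReal.ofReal (∑ m, y m x ^ 2) ∂μ

variable {y D} [DecidableEq ι] {w : E → ℂ}

theorem hardyTerm_add_hardyTerm [μ.IsAddHaarMeasure]
    (hyD : ∀ k l, y k (D l) = if k = l then 1 else 0) (hw : ContDiff ℝ 1 w) (s : Finset ι) :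
    hardyTerm μ y (fun x => (w x + w (reflect y D s x)) / 2) +
      hardyTerm μ y (fun x => (w x - w (reflect y D s x)) / 2) = hardyTerm μ y w := by
  unfold hardyTerm
  simp only [div_eq_mul_inv (_ : ℝ≥0∞)]
  refine lintegral_parallelogram (measurePreserving_of_involutive μ (reflect y D s)
    (reflect_reflect hyD s)) (c := fun x => w (reflect y D s x)) hw.continuous.measurable ?_ ?_
    (fun _ => rfl) (fun _ => rfl) fun x => ?_
  · have := hw.continuous
    exact Continuous.measurable (by fun_prop)
  · have : Continuous fun x => ∑ m, y m x ^ 2 := continuous_sum_sq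
    exact this.measurable.ennreal_ofReal.inv
  · simp only [coord_reflect_sq hyD]

theorem energy_add_energy [μ.IsAddHaarMeasure]
    (hyD : ∀ k l, y k (D l) = if k = l then 1 else 0) (hw : ContDiff ℝ 1 w) (s : Finset ι) :
    energy μ D (fun x => (w x + w (reflect y D s x)) / 2) +
      energy μ D (fun x => (w x - w (reflect y D s x)) / 2) = energy μ D w := by
  have hm : ∀ (f : E → ℂ) l, Measurable fun x => ‖fderiv ℝ f x (D l)‖ₑ ^ 2 := fun f l =>
    ((measurable_fderiv_apply_const ℝ f (D l)).enorm).pow_const 2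
  unfold energy
  rw [lintegral_finsetSum _ fun l _ => hm _ l, lintegral_finsetSum _ fun l _ => hm _ l,
    lintegral_finsetSum _ fun l _ => hm _ l, ← Finset.sum_add_distrib]
  refine Finset.sum_congr rfl fun l _ => ?_
  have hd : Differentiable ℝ w := hw.differentiable one_ne_zero
  have hd' : Differentiable ℝ fun x => w (reflect y D s x) :=
    hd.comp (reflect y D s).differentiable
  have h1 : ∀ x, fderiv ℝ (fun x => (w x + w (reflect y D s x)) / 2) x (D l) =
      (fderiv ℝ w x (D l) + fderiv ℝ w (reflect y D s x) (reflect y D s (D l))) / 2 := by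
    intro x
    simp only [div_eq_inv_mul]
    rw [← fderiv_comp_clm_apply hw, fderiv_const_mul ((hd x).fun_add (hd' x)),
      fderiv_fun_add (hd x) (hd' x)]
    simp [mul_add]
  have h2 : ∀ x, fderiv ℝ (fun x => (w x - w (reflect y D s x)) / 2) x (D l) =
      (fderiv ℝ w x (D l) - fderiv ℝ w (reflect y D s x) (reflect y D s (D l))) / 2 := by
    intro x
    simp only [div_eq_inv_mul]
    rw [← fderiv_comp_clm_apply hw, fderiv_const_mul ((hd x).fun_sub (hd' x)),
      fderiv_fun_sub (hd x) (hd' x)]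
    simp
  have := lintegral_parallelogram (measurePreserving_of_involutive μ (reflect y D s)
    (reflect_reflect hyD s)) (ρ := fun _ => 1) (measurable_fderiv_apply_const ℝ w (D l))
    (measurable_fderiv_apply_const ℝ _ (D l)) measurable_const
    (c := fun x => fderiv ℝ w (reflect y D s x) (reflect y D s (D l))) (fun x => ?_) h1
    (fun _ => rfl)
  · simpa only [mul_one, ← h2] using this
  · simp only [reflect_dir hyD]
    split_ifs <;> simp

/-- Induction on the set of reflected coordinates. Split `w` into its even and odd parts in `y_k`:
the odd part falls under `hardy_of_odd_coord`, the even part is odd under the remaining reflections.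
With no coordinate left, `w = -w = 0`. -/
theorem hardy_of_odd [μ.IsAddHaarMeasure]
    (hyD : ∀ k l, y k (D l) = if k = l then 1 else 0) (s : Finset ι) :
    ∀ w : E → ℂ, ContDiff ℝ 1 w → HasCompactSupport w → (∀ x, w (reflect y D s x) = - w x) →
    ENNReal.ofReal (((Fintype.card ι : ℝ) / 2) ^ 2) * hardyTerm μ y w ≤ energy μ D w := by
  induction s using Finset.induction_on with
  | empty =>
    intro w _ _ hodd
    have h0 : ∀ x, w x = 0 := fun x => by
      have := hodd x
      rw [reflect_apply, Finset.sum_empty, sub_zero] at this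
      exact self_eq_neg.1 this
    simp [hardyTerm, h0]
  | insert k s hk ih =>
    intro w hw hc hodd
    have hR := reflect_reflect hyD {k}
    have hw' : ContDiff ℝ 1 fun x => w (reflect y D {k} x) := hw.comp (reflect y D {k}).contDiff
    have hc' := hasCompactSupport_comp_of_involutive hc hR
    rw [← energy_add_energy μ hyD hw {k}, ← hardyTerm_add_hardyTerm μ hyD hw {k}, mul_add]
    refine add_le_add ?_ ?_
    · refine ih _ ((hw.add hw').div_const 2) ?_ fun x => ?_
      · exact (hc.add hc').comp_left (g := fun z : ℂ => z / 2) (by simp)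
      · have h1 := hodd (reflect y D {k} x)
        rw [reflect_insert' hyD hk, hR] at h1
        have h2 := hodd x
        rw [reflect_insert hyD hk] at h2
        rw [h1, h2]
        ring
    · refine hardy_of_odd_coord μ hyD ((hw.sub hw').div_const 2) ?_ k fun x => ?_
      · exact (hc.sub hc').comp_left (g := fun z : ℂ => z / 2) (by simp)
      · have h1 : x - (2 * y k x) • D k = reflect y D {k} x := by simp [reflect_apply]
        rw [h1, hR]
        ring

/-- The **Hardy inequality** for the odd part of a function, with the constant `(d/2)²`. -/
theorem hardy_odd_part [μ.IsAddHaarMeasure]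
    (hyD : ∀ k l, y k (D l) = if k = l then 1 else 0) (hw : ContDiff ℝ 1 w)
    (hc : HasCompactSupport w) :
    ENNReal.ofReal (((Fintype.card ι : ℝ) / 2) ^ 2) *
      hardyTerm μ y (fun x => (w x - w (reflect y D Finset.univ x)) / 2) ≤ energy μ D w := by
  have hR := reflect_reflect hyD Finset.univ
  have hw' : ContDiff ℝ 1 fun x => w (reflect y D Finset.univ x) :=
    hw.comp (reflect y D Finset.univ).contDiff
  have hc' := hasCompactSupport_comp_of_involutive hc hR
  refine (hardy_of_odd μ hyD Finset.univ _ ((hw.sub hw').div_const 2) ?_ fun x => ?_).trans ?_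
  · exact (hc.sub hc').comp_left (g := fun z : ℂ => z / 2) (by simp)
  · rw [hR]
    ring
  · rw [← energy_add_energy μ hyD hw Finset.univ]
    exact le_add_self

end Hardy

end OddHardy

/-! ### Approximation by mollification and cutoff -/

namespace OddHardy

open Filter Topology

theorem eLpNorm_two_sq {X : Type*} [MeasurableSpace X] {F : Type*} [NormedAddCommGroup F]
    (μ : Measure X) (f : X → F) : eLpNorm f 2 μ ^ 2 = ∫⁻ x, ‖f x‖ₑ ^ 2 ∂μ := by
  have := eLpNorm_nnreal_pow_eq_lintegral (μ := μ) (f := f) (p := 2) two_ne_zero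
  simpa using this

theorem eLpNorm_cutoff_deriv_le {E : Type*} [NormedAddCommGroup E] [NormedSpace ℝ E]
    [MeasurableSpace E] [BorelSpace E] [SecondCountableTopology E] (μ : Measure E) {χ : E → ℝ} {U : E → ℂ} {v : E} {a C : ℝ} (ha : 0 < a)
    (hχ : ContDiff ℝ 1 χ) (hχ1 : ∀ x, ‖χ x‖ ≤ 1) (hC : ∀ x, ‖fderiv ℝ χ x‖ ≤ C)
    (hU : ContDiff ℝ 1 U) :
    eLpNorm (fun x => fderiv ℝ (fun x => χ (a • x) • U x) x v) 2 μ ≤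
      eLpNorm (fun x => fderiv ℝ U x v) 2 μ + ENNReal.ofReal (C * ‖v‖ * a) * eLpNorm U 2 μ := by
  have hder : ∀ x, fderiv ℝ (fun x => χ (a • x) • U x) x v =
      χ (a • x) • fderiv ℝ U x v + (a * fderiv ℝ χ (a • x) v) • U x := by
    intro x
    have hd1 : HasFDerivAt (fun x => χ (a • x)) (a • fderiv ℝ χ (a • x)) x := by
      have := ((hχ.differentiable one_ne_zero (a • x)).hasFDerivAt).comp x
        ((hasFDerivAt_id x).const_smul a)
      refine this.congr_fderiv ?_
      ext z
      simp
    rw [(hd1.fun_smul (hU.differentiable one_ne_zero x).hasFDerivAt).fderiv]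
    simp
  have hcg : Continuous fun x => fderiv ℝ U x v :=
    (hU.continuous_fderiv one_ne_zero).clm_apply continuous_const
  have hcd : Continuous fun x => fderiv ℝ χ (a • x) v :=
    ((hχ.continuous_fderiv one_ne_zero).comp (continuous_const_smul a)).clm_apply continuous_const
  have hcχ : Continuous fun x => χ (a • x) := hχ.continuous.comp (continuous_const_smul a)
  simp only [hder]
  refine (eLpNorm_add_le (f := fun x => χ (a • x) • fderiv ℝ U x v)
    (g := fun x => (a * fderiv ℝ χ (a • x) v) • U x) (hcχ.smul hcg).aestronglyMeasurable
    ((continuous_const.mul hcd).smul hU.continuous).aestronglyMeasurable (by norm_num)).trans ?_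
  refine add_le_add ?_ ?_
  · refine eLpNorm_mono fun x => ?_
    rw [norm_smul]
    exact mul_le_of_le_one_left (norm_nonneg _) (hχ1 _)
  · refine eLpNorm_le_mul_eLpNorm_of_ae_le_mul (Eventually.of_forall fun x => ?_) 2
    rw [norm_smul, norm_mul, Real.norm_of_nonneg ha.le]
    refine mul_le_mul_of_nonneg_right ?_ (norm_nonneg _)
    rw [mul_comm]
    refine mul_le_mul_of_nonneg_right ?_ ha.le
    exact ((fderiv ℝ χ (a • x)).le_opNorm v).trans
      (mul_le_mul_of_nonneg_right (hC _) (norm_nonneg _))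

theorem exists_approximate_identity {E : Type*} [NormedAddCommGroup E] : ∃ φ : ℕ → ContDiffBump (0 : E),
    Tendsto (fun n => (φ n).rOut) atTop (𝓝 0) ∧ ∀ n, (φ n).rOut ≤ 2 * (φ n).rIn := by
  refine ⟨fun n => ⟨1 / ((n : ℝ) + 1), 2 * (1 / ((n : ℝ) + 1)), by positivity, ?_⟩, ?_,
    fun n => le_rfl⟩
  · have : 0 < 1 / ((n : ℝ) + 1) := by positivity
    linarith
  · simpa using (tendsto_one_div_add_atTop_nhds_zero_nat (𝕜 := ℝ)).const_mul 2

theorem exists_cutoff {E : Type*} [NormedAddCommGroup E] [NormedSpace ℝ E]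
    [FiniteDimensional ℝ E] : ∃ (χ : E → ℝ) (C : ℝ), ContDiff ℝ 1 χ ∧ HasCompactSupport χ ∧ χ 0 = 1 ∧
    (∀ x, ‖χ x‖ ≤ 1) ∧ ∀ x, ‖fderiv ℝ χ x‖ ≤ C := by
  let χ : ContDiffBump (0 : E) := ⟨1, 2, one_pos, one_lt_two⟩
  have hχ1 : ContDiff ℝ 1 χ := χ.contDiff
  obtain ⟨C, hC⟩ := (hχ1.continuous_fderiv one_ne_zero).bounded_above_of_compact_support
    (χ.hasCompactSupport.fderiv ℝ)
  refine ⟨χ, C, hχ1, χ.hasCompactSupport, χ.one_of_mem_closedBall (by simp [χ]), fun x => ?_, hC⟩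
  rw [Real.norm_of_nonneg χ.nonneg]
  exact χ.le_one

variable {E : Type*} [NormedAddCommGroup E] [NormedSpace ℝ E] [FiniteDimensional ℝ E]
  [MeasurableSpace E] [BorelSpace E] (μ : Measure E) [μ.IsAddHaarMeasure]

/-- The function `g` is the weak derivative of `u` in the direction `v`. -/
def HasWeakDirDeriv (u g : E → ℂ) (v : E) : Prop :=
  ∀ φ : E → ℝ, ContDiff ℝ ∞ φ → HasCompactSupport φ →
    ∫ x, (fderiv ℝ φ x v) • u x ∂μ = - ∫ x, φ x • g x ∂μ

theorem lintegral_ofReal_normed (φ : ContDiffBump (0 : E)) :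
    ∫⁻ t, ENNReal.ofReal (φ.normed μ t) ∂μ = 1 := by
  rw [← ofReal_integral_eq_lintegral_ofReal φ.integrable_normed
    (Eventually.of_forall φ.nonneg_normed), φ.integral_normed, ENNReal.ofReal_one]

open ContinuousLinearMap in
-- Jensen's inequality: the mollifier is a probability density, and the `L¹` norm is at most the
-- `L²` norm for a probability measure.
theorem enorm_convolution_normed_sq_le (φ : ContDiffBump (0 : E)) {g : E → ℂ}
    (hg : AEStronglyMeasurable g μ) (x : E) :
    ‖convolution (φ.normed μ) g (lsmul ℝ ℝ) μ x‖ₑ ^ 2 ≤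
      ∫⁻ t, ENNReal.ofReal (φ.normed μ t) * ‖g (x - t)‖ₑ ^ 2 ∂μ := by
  set ρ : E → ℝ≥0∞ := fun t => ENNReal.ofReal (φ.normed μ t) with hρ
  have hρm : Measurable ρ := φ.continuous_normed.measurable.ennreal_ofReal
  set ν := μ.withDensity ρ with hν
  have hprob : IsProbabilityMeasure ν := ⟨by
    rw [hν, withDensity_apply _ MeasurableSet.univ, Measure.restrict_univ]
    exact lintegral_ofReal_normed μ φ⟩
  have hfin : ∀ᵐ t ∂μ, ρ t < ⊤ := Eventually.of_forall fun t => ENNReal.ofReal_lt_top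
  have hgx : AEStronglyMeasurable (fun t => g (x - t)) ν :=
    (hg.comp_quasiMeasurePreserving (quasiMeasurePreserving_sub_left μ x)).mono_ac
      (withDensity_absolutelyContinuous μ ρ)
  have h1 : ‖convolution (φ.normed μ) g (lsmul ℝ ℝ) μ x‖ₑ ≤ eLpNorm (fun t => g (x - t)) 1 ν := by
    rw [convolution_def, eLpNorm_one_eq_lintegral_enorm, hν,
      lintegral_withDensity_eq_lintegral_mul_non_measurable _ hρm hfin]
    refine (enorm_integral_le_lintegral_enorm _).trans (lintegral_mono fun t => ?_)
    rw [lsmul_apply, enorm_smul, Pi.mul_apply, hρ, Real.enorm_of_nonneg (φ.nonneg_normed t)]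
  have h2 := h1.trans (eLpNorm_le_eLpNorm_of_exponent_le (by norm_num : (1 : ℝ≥0∞) ≤ 2) hgx)
  refine (pow_le_pow_left' h2 2).trans (le_of_eq ?_)
  rw [eLpNorm_two_sq, hν, lintegral_withDensity_eq_lintegral_mul_non_measurable _ hρm hfin]
  rfl

open ContinuousLinearMap in
theorem eLpNorm_convolution_normed_le (φ : ContDiffBump (0 : E)) {g : E → ℂ}
    (hg : AEStronglyMeasurable g μ) :
    eLpNorm (convolution (φ.normed μ) g (lsmul ℝ ℝ) μ) 2 μ ≤ eLpNorm g 2 μ := by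
  have h : eLpNorm (convolution (φ.normed μ) g (lsmul ℝ ℝ) μ) 2 μ ^ 2 ≤ eLpNorm g 2 μ ^ 2 := by
    rw [eLpNorm_two_sq, eLpNorm_two_sq]
    refine (lintegral_mono fun x => enorm_convolution_normed_sq_le μ φ hg x).trans ?_
    have hρm : Measurable fun t => ENNReal.ofReal (φ.normed μ t) :=
      φ.continuous_normed.measurable.ennreal_ofReal
    rw [lintegral_lintegral_swap]
    · have hinv : ∀ t, ∫⁻ x, ‖g (x - t)‖ₑ ^ 2 ∂μ = ∫⁻ x, ‖g x‖ₑ ^ 2 ∂μ := fun t =>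
        lintegral_sub_right_eq_self (fun x => ‖g x‖ₑ ^ 2) t
      have : ∀ t, ∫⁻ x, ENNReal.ofReal (φ.normed μ t) * ‖g (x - t)‖ₑ ^ 2 ∂μ =
          ENNReal.ofReal (φ.normed μ t) * ∫⁻ x, ‖g x‖ₑ ^ 2 ∂μ := fun t => by
        rw [lintegral_const_mul' _ _ ENNReal.ofReal_ne_top, hinv]
      simp only [this]
      rw [lintegral_mul_const _ hρm, lintegral_ofReal_normed, one_mul]
    · refine (hρm.comp measurable_snd).aemeasurable.mul ?_
      exact ((hg.comp_quasiMeasurePreserving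
        (quasiMeasurePreserving_sub μ μ)).enorm).pow_const 2
  exact (ENNReal.pow_le_pow_left_iff two_ne_zero).1 h

open ContinuousLinearMap in
theorem fderiv_convolution_normed (φ : ContDiffBump (0 : E)) {u g : E → ℂ} {v : E}
    (hu : LocallyIntegrable u μ) (hug : HasWeakDirDeriv μ u g v) (x : E) :
    fderiv ℝ (convolution (φ.normed μ) u (lsmul ℝ ℝ) μ) x v =
      convolution (φ.normed μ) g (lsmul ℝ ℝ) μ x := by
  have hc := φ.hasCompactSupport_normed (μ := μ)
  have hφ : ContDiff ℝ ∞ (φ.normed μ) := φ.contDiff_normed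
  have hφ1 : ContDiff ℝ 1 (φ.normed μ) := φ.contDiff_normed
  rw [(hc.hasFDerivAt_convolution_left (lsmul ℝ ℝ) hφ1 hu x).fderiv]
  have hex : ConvolutionExistsAt (fderiv ℝ (φ.normed μ)) u x
      ((lsmul ℝ ℝ : ℝ →L[ℝ] ℂ →L[ℝ] ℂ).precompL E) μ :=
    ((hc.fderiv ℝ).convolutionExists_left _ (hφ1.continuous_fderiv one_ne_zero) hu) x
  rw [convolution_eq_swap, convolution_eq_swap, ContinuousLinearMap.integral_apply
    hex.integrable_swap]
  -- Test the weak derivative against the reflected, translated mollifier; the sign from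
  -- differentiating `x - t` cancels the one in the definition.
  have hψ := hug (fun t => φ.normed μ (x - t)) (hφ.comp (contDiff_const.sub contDiff_id))
    (hc.comp_homeomorph (Homeomorph.subLeft x))
  rw [eq_neg_iff_add_eq_zero, add_comm, ← eq_neg_iff_add_eq_zero] at hψ
  simp only [lsmul_apply]
  rw [hψ, ← integral_neg]
  refine integral_congr_ae (Eventually.of_forall fun t => ?_)
  have hd : fderiv ℝ (fun t => φ.normed μ (x - t)) t v = - fderiv ℝ (φ.normed μ) (x - t) v := by
    have h1 := ((hφ1.differentiable one_ne_zero (x - t)).hasFDerivAt).comp t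
      ((hasFDerivAt_id t).const_sub x)
    have h2 := h1.fderiv
    simp only [Function.comp_def] at h2
    rw [h2]
    simp
  simp only [hd, neg_smul, neg_neg]
  rfl

open ContinuousLinearMap in
/-- Compactly supported `C¹` approximations of a function in `L²` that do not increase the
`L²` norms of the weak derivatives by more than `o(1)`. -/
theorem exists_approximation {u : E → ℂ} (hu : LocallyIntegrable u μ) :
    ∃ (w : ℕ → E → ℂ) (C : ℝ), (∀ n, ContDiff ℝ 1 (w n)) ∧ (∀ n, HasCompactSupport (w n)) ∧
      (∀ᵐ x ∂μ, Tendsto (fun n => w n x) atTop (𝓝 (u x))) ∧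
      ∀ (n : ℕ) (v : E) (g : E → ℂ), LocallyIntegrable g μ → HasWeakDirDeriv μ u g v →
        eLpNorm (fun x => fderiv ℝ (w n) x v) 2 μ ≤
          eLpNorm g 2 μ + ENNReal.ofReal (C * ‖v‖ * (1 / ((n : ℝ) + 1))) * eLpNorm u 2 μ := by
  obtain ⟨φ, hφ0, hφ2⟩ := exists_approximate_identity (E := E)
  obtain ⟨χ, C, hχ, hχc, hχ0, hχ1, hC⟩ := exists_cutoff (E := E)
  have ha : ∀ n : ℕ, 0 < 1 / ((n : ℝ) + 1) := fun n => by positivity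
  have hU : ∀ n, ContDiff ℝ 1 (convolution ((φ n).normed μ) u (lsmul ℝ ℝ) μ) := fun n =>
    (φ n).hasCompactSupport_normed.contDiff_convolution_left _ (φ n).contDiff_normed hu
  refine ⟨fun n x => χ ((1 / ((n : ℝ) + 1)) • x) •
    convolution ((φ n).normed μ) u (lsmul ℝ ℝ) μ x, C, fun n => ?_, fun n => ?_, ?_, ?_⟩
  · exact (hχ.comp (contDiff_const_smul (1 / ((n : ℝ) + 1)))).smul (hU n)
  · have h := hχc.comp_homeomorph (Homeomorph.smulOfNeZero (1 / ((n : ℝ) + 1)) (ha n).ne')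
    refine h.mono fun x hx h0 => hx ?_
    have h0' : χ ((1 / ((n : ℝ) + 1)) • x) = 0 := h0
    simp only [h0', zero_smul]
  · filter_upwards [ContDiffBump.ae_convolution_tendsto_right_of_locallyIntegrable (K := 2) hφ0
      (Eventually.of_forall hφ2) hu] with x hx
    have h1 : Tendsto (fun n : ℕ => (1 / ((n : ℝ) + 1)) • x) atTop (𝓝 0) := by
      simpa using (tendsto_one_div_add_atTop_nhds_zero_nat (𝕜 := ℝ)).smul_const x
    have h2 := (hχ.continuous.tendsto 0).comp h1
    rw [hχ0] at h2
    simpa [Function.comp_def] using h2.smul hx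
  · intro n v g hg hug
    refine (eLpNorm_cutoff_deriv_le μ (ha n) hχ hχ1 hC (hU n)).trans ?_
    simp only [fderiv_convolution_normed μ (φ n) hu hug]
    gcongr
    · exact eLpNorm_convolution_normed_le μ (φ n) hg.aestronglyMeasurable
    · exact eLpNorm_convolution_normed_le μ (φ n) hu.aestronglyMeasurable

end OddHardy

/-! ### Relative coordinates and summation over pairs -/

namespace ManyParticle

open Filter Topology

open OddHardy

theorem sum_sum_Ioi_norm_sub_sq_le {N : ℕ} (a : Fin N → ℂ) :
    ∑ i, ∑ j ∈ Finset.Ioi i, ‖a i - a j‖ ^ 2 ≤ N * ∑ i, ‖a i‖ ^ 2 := by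
  -- Lagrange's identity; the ordered pairs count each unordered pair twice.
  have h1 : ∑ i, ∑ j, ‖a i - a j‖ ^ 2 = 2 * (N * ∑ i, ‖a i‖ ^ 2) - 2 * ‖∑ i, a i‖ ^ 2 := by
    have h : ∀ i j, ‖a i - a j‖ ^ 2 = ‖a i‖ ^ 2 - 2 * inner ℝ (a i) (a j) + ‖a j‖ ^ 2 :=
      fun i j => norm_sub_sq_real _ _
    simp only [h, Finset.sum_add_distrib, Finset.sum_sub_distrib, ← Finset.mul_sum, ← inner_sum,
      ← sum_inner, real_inner_self_eq_norm_sq]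
    simp only [Finset.sum_const, Finset.card_univ, Fintype.card_fin, nsmul_eq_mul, ← Finset.mul_sum]
    ring
  have h2 : ∑ i, ∑ j ∈ Finset.Ioi i, ‖a i - a j‖ ^ 2 = ∑ i, ∑ j ∈ Finset.Iio i, ‖a i - a j‖ ^ 2 := by
    rw [Finset.sum_comm' (t' := Finset.univ) (s' := fun j => Finset.Iio j) (by simp)]
    exact Finset.sum_congr rfl fun i _ => Finset.sum_congr rfl fun j _ => by rw [norm_sub_rev]
  have h3 : ∑ i, ∑ j ∈ Finset.Ioi i, ‖a i - a j‖ ^ 2 + ∑ i, ∑ j ∈ Finset.Iio i, ‖a i - a j‖ ^ 2 ≤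
      ∑ i, ∑ j, ‖a i - a j‖ ^ 2 := by
    rw [← Finset.sum_add_distrib]
    refine Finset.sum_le_sum fun i _ => ?_
    rw [← Finset.sum_union (Finset.disjoint_left.2 fun j hj hj' =>
      lt_asymm (Finset.mem_Ioi.1 hj) (Finset.mem_Iio.1 hj'))]
    exact Finset.sum_le_sum_of_subset_of_nonneg (Finset.subset_univ _) fun _ _ _ => sq_nonneg _
  nlinarith [sq_nonneg ‖∑ i, a i‖]

theorem sum_sum_Ioi_enorm_sub_sq_le {N : ℕ} (a : Fin N → ℂ) :
    ∑ i, ∑ j ∈ Finset.Ioi i, ‖a i - a j‖ₑ ^ 2 ≤ N * ∑ i, ‖a i‖ₑ ^ 2 := by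
  have h := ENNReal.ofReal_le_ofReal (sum_sum_Ioi_norm_sub_sq_le a)
  rw [ENNReal.ofReal_mul (by positivity), ENNReal.ofReal_natCast,
    ENNReal.ofReal_sum_of_nonneg fun _ _ => by positivity,
    ENNReal.ofReal_sum_of_nonneg fun _ _ => by positivity] at h
  simp only [ENNReal.ofReal_sum_of_nonneg fun _ _ => sq_nonneg (norm _),
    ENNReal.ofReal_pow (norm_nonneg _), ofReal_norm] at h
  exact h

theorem enorm_sq_eq_sum {d : ℕ} {𝕜 : Type*} [RCLike 𝕜] (v : EuclideanSpace 𝕜 (Fin d)) :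
    ‖v‖ₑ ^ 2 = ∑ k, ‖v k‖ₑ ^ 2 := by
  have h := congrArg ENNReal.ofReal (EuclideanSpace.norm_sq_eq v)
  rw [ENNReal.ofReal_sum_of_nonneg fun _ _ => sq_nonneg _] at h
  simpa only [ENNReal.ofReal_pow (norm_nonneg _), ofReal_norm] using h

variable {d N : ℕ}

/-- The `k`-th coordinate of `x_i - x_j`. -/
noncomputable def relCoord (i j : Fin N) (k : Fin d) : Config d N →L[ℝ] ℝ :=
  (EuclideanSpace.proj k : EuclideanSpace ℝ (Fin d) →L[ℝ] ℝ) ∘L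
    (ContinuousLinearMap.proj (R := ℝ) (φ := fun _ : Fin N => EuclideanSpace ℝ (Fin d)) i -
      ContinuousLinearMap.proj (R := ℝ) (φ := fun _ : Fin N => EuclideanSpace ℝ (Fin d)) j)

/-- The direction in which `x_i - x_j` moves along the `k`-th basis vector with unit speed, while
`x_i + x_j` and the other particles are at rest. -/
noncomputable def relDir (i j : Fin N) (k : Fin d) : Config d N :=
  (2⁻¹ : ℝ) • (dir i k - dir j k)

theorem relCoord_apply (i j : Fin N) (k : Fin d) (x : Config d N) :
    relCoord i j k x = x i k - x j k := by
  simp [relCoord]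

theorem dir_apply (j l : Fin N) (k m : Fin d) :
    (dir j k : Config d N) l m = if l = j ∧ m = k then 1 else 0 := by
  by_cases h : l = j
  · subst h
    simp [dir]
  · simp [dir, h]

theorem relCoord_relDir {i j : Fin N} (hij : i ≠ j) (k l : Fin d) :
    relCoord i j k (relDir i j l) = if k = l then 1 else 0 := by
  rw [relCoord_apply]
  simp only [relDir, Pi.smul_apply, Pi.sub_apply, PiLp.smul_apply, PiLp.sub_apply, dir_apply,
    smul_eq_mul, hij, hij.symm, true_and, false_and, if_false]
  split_ifs <;> norm_num

theorem reflect_relCoord {i j : Fin N} (hij : i ≠ j) (x : Config d N) :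
    reflect (relCoord i j) (relDir i j) Finset.univ x = fun l => x (Equiv.swap i j l) := by
  rw [reflect_apply]
  ext l m
  have h : (∑ k, (2 * relCoord i j k x) • relDir i j k : Config d N) l m =
      ∑ k, (2 * relCoord i j k x) • (relDir i j k l m) := by
    simp [Finset.sum_apply]
  rw [Pi.sub_apply, PiLp.sub_apply, h]
  simp only [relDir, Pi.smul_apply, Pi.sub_apply, PiLp.smul_apply, PiLp.sub_apply, dir_apply,
    relCoord_apply, smul_eq_mul]
  rcases eq_or_ne l i with rfl | hi
  · simp [hij]
    ring
  · rcases eq_or_ne l j with rfl | hj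
    · simp [hij.symm]
      ring
    · simp [hi, hj, Equiv.swap_apply_of_ne_of_ne hi hj]

theorem ofReal_sum_relCoord_sq (i j : Fin N) (x : Config d N) :
    ENNReal.ofReal (∑ k, relCoord i j k x ^ 2) = ‖x i - x j‖ₑ ^ 2 := by
  simp only [relCoord_apply]
  rw [← ofReal_norm, ← ENNReal.ofReal_pow (norm_nonneg _), EuclideanSpace.real_norm_sq_eq]
  rfl

/-- The collision set lies in the kernel of one nonzero linear functional, which exists since `d ≥
1`. -/
theorem ae_enorm_sub_ne_zero (hd : 1 ≤ d) {i j : Fin N} (hij : i ≠ j) :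
    ∀ᵐ x : Config d N, ‖x i - x j‖ₑ ^ 2 ≠ 0 := by
  have h : volume ((LinearMap.ker (relCoord i j (⟨0, hd⟩ : Fin d)).toLinearMap :
      Submodule ℝ (Config d N)) : Set (Config d N)) = 0 := by
    refine Measure.addHaar_submodule _ _ fun htop => ?_
    have h1 : relDir i j (⟨0, hd⟩ : Fin d) ∈
        LinearMap.ker (relCoord i j (⟨0, hd⟩ : Fin d)).toLinearMap := by simp [htop]
    have h2 := relCoord_relDir hij (⟨0, hd⟩ : Fin d) ⟨0, hd⟩
    rw [LinearMap.mem_ker] at h1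
    simp only [ContinuousLinearMap.coe_coe] at h1
    rw [h1] at h2
    simp at h2
  refine measure_mono_null (fun x hx => ?_) h
  have hx' : x i = x j := by simpa [sub_eq_zero] using hx
  simp [relCoord_apply, hx']

/-- The part of `w` that is anti-symmetric in the particles `i` and `j`. -/
noncomputable def antisymmPart (i j : Fin N) (w : Config d N → ℂ) (x : Config d N) : ℂ :=
  (w x - w (fun l => x (Equiv.swap i j l))) / 2

theorem four_mul_energy_relDir {w : Config d N → ℂ} (i j : Fin N) :
    4 * energy volume (relDir i j) w =
      ∫⁻ x, ∑ k : Fin d, ‖fderiv ℝ w x (dir i k) - fderiv ℝ w x (dir j k)‖ₑ ^ 2 := by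
  unfold energy
  rw [← lintegral_const_mul' _ _ (by simp)]
  refine lintegral_congr fun x => ?_
  rw [Finset.mul_sum]
  refine Finset.sum_congr rfl fun k _ => ?_
  rw [relDir, map_smul, map_sub, enorm_smul, mul_pow, ← mul_assoc,
    Real.enorm_of_nonneg (by norm_num), ← ENNReal.ofReal_pow (by norm_num),
    ← ENNReal.ofReal_ofNat, ← ENNReal.ofReal_mul (by norm_num)]
  norm_num

theorem hardy_antisymmPart {w : Config d N → ℂ} (hw : ContDiff ℝ 1 w) (hc : HasCompactSupport w)
    {i j : Fin N} (hij : i ≠ j) :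
    (d : ℝ≥0∞) ^ 2 * ∫⁻ x, ‖antisymmPart i j w x‖ₑ ^ 2 / ‖x i - x j‖ₑ ^ 2 ≤
      ∫⁻ x, ∑ k : Fin d, ‖fderiv ℝ w x (dir i k) - fderiv ℝ w x (dir j k)‖ₑ ^ 2 := by
  have h := hardy_odd_part (volume : Measure (Config d N)) (relCoord_relDir hij) hw hc
  rw [← four_mul_energy_relDir]
  refine le_trans (le_of_eq ?_) (mul_le_mul_right h 4)
  rw [← mul_assoc]
  congr 1
  · rw [← ENNReal.ofReal_ofNat, ← ENNReal.ofReal_mul (by norm_num), Fintype.card_fin,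
      ← ENNReal.ofReal_natCast, ← ENNReal.ofReal_pow (by positivity)]
    congr 1
    ring
  · unfold hardyTerm
    simp only [ofReal_sum_relCoord_sq, reflect_relCoord hij]
    rfl

theorem many_particle_hardy_of_contDiff {w : Config d N → ℂ} (hw : ContDiff ℝ 1 w)
    (hc : HasCompactSupport w) :
    (d : ℝ≥0∞) ^ 2 * ∑ i : Fin N, ∑ j ∈ Finset.Ioi i,
        ∫⁻ x, ‖antisymmPart i j w x‖ₑ ^ 2 / ‖x i - x j‖ₑ ^ 2 ≤
      N * ∑ j : Fin N, ∑ k : Fin d, eLpNorm (fun x => fderiv ℝ w x (dir j k)) 2 volume ^ 2 := by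
  have hm : ∀ (i j : Fin N) (k : Fin d), Measurable fun x =>
      ‖fderiv ℝ w x (dir i k) - fderiv ℝ w x (dir j k)‖ₑ ^ 2 := fun i j k =>
    (((measurable_fderiv_apply_const ℝ w _).sub
      (measurable_fderiv_apply_const ℝ w _)).enorm).pow_const 2
  have hm' : ∀ (j : Fin N) (k : Fin d), Measurable fun x => ‖fderiv ℝ w x (dir j k)‖ₑ ^ 2 :=
    fun j k => ((measurable_fderiv_apply_const ℝ w _).enorm).pow_const 2
  calc (d : ℝ≥0∞) ^ 2 * ∑ i : Fin N, ∑ j ∈ Finset.Ioi i,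
        ∫⁻ x, ‖antisymmPart i j w x‖ₑ ^ 2 / ‖x i - x j‖ₑ ^ 2
      ≤ ∑ i : Fin N, ∑ j ∈ Finset.Ioi i,
          ∫⁻ x, ∑ k : Fin d, ‖fderiv ℝ w x (dir i k) - fderiv ℝ w x (dir j k)‖ₑ ^ 2 := by
        simp only [Finset.mul_sum]
        exact Finset.sum_le_sum fun i _ => Finset.sum_le_sum fun j hj =>
          hardy_antisymmPart hw hc (Finset.mem_Ioi.1 hj).ne
    _ = ∫⁻ x, ∑ i : Fin N, ∑ j ∈ Finset.Ioi i, ∑ k : Fin d,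
          ‖fderiv ℝ w x (dir i k) - fderiv ℝ w x (dir j k)‖ₑ ^ 2 := by
        rw [lintegral_finsetSum _ fun i _ => Finset.measurable_fun_sum _ fun j _ =>
          Finset.measurable_fun_sum _ fun k _ => hm i j k]
        refine Finset.sum_congr rfl fun i _ => ?_
        rw [lintegral_finsetSum _ fun j _ => Finset.measurable_fun_sum _ fun k _ => hm i j k]
    _ ≤ ∫⁻ x, ∑ k : Fin d, N * ∑ j : Fin N, ‖fderiv ℝ w x (dir j k)‖ₑ ^ 2 :=
        lintegral_mono fun x => by
          simp only [Finset.sum_comm (s := Finset.Ioi _) (t := Finset.univ)]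
          rw [Finset.sum_comm]
          exact Finset.sum_le_sum fun k _ => sum_sum_Ioi_enorm_sub_sq_le _
    _ = N * ∑ j : Fin N, ∑ k : Fin d, eLpNorm (fun x => fderiv ℝ w x (dir j k)) 2 volume ^ 2 := by
        simp only [eLpNorm_two_sq, ← Finset.mul_sum]
        rw [lintegral_const_mul' _ _ (by simp), lintegral_finsetSum _ fun k _ =>
          Finset.measurable_fun_sum _ fun j _ => hm' j k, Finset.sum_comm]
        simp only [lintegral_finsetSum _ fun j _ => hm' j _]

/-! ### From smooth functions to weak gradients -/

theorem hasWeakDirDeriv_of_hasWeakGradient {u : Config d N → ℂ}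
    {G : Fin N → Config d N → EuclideanSpace ℂ (Fin d)} (hG : HasWeakGradient u G) (j : Fin N)
    (k : Fin d) : HasWeakDirDeriv volume u (fun x => G j x k) (dir j k) :=
  fun φ hφ hc => hG.integral_eq φ hφ hc j k

theorem locallyIntegrable_coord {G : Config d N → EuclideanSpace ℂ (Fin d)}
    (hG : LocallyIntegrable G volume) (k : Fin d) :
    LocallyIntegrable (fun x => G x k) volume :=
  hG.mono ((EuclideanSpace.proj k : EuclideanSpace ℂ (Fin d) →L[ℂ] ℂ).continuous.comp_aestronglyMeasurable
    hG.aestronglyMeasurable) (Eventually.of_forall fun x => PiLp.norm_apply_le (G x) k)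

theorem sum_eLpNorm_coord_sq {G : Config d N → EuclideanSpace ℂ (Fin d)}
    (hG : LocallyIntegrable G volume) :
    ∑ k, eLpNorm (fun x => G x k) 2 volume ^ 2 = ∫⁻ x, ‖G x‖ₑ ^ 2 := by
  simp only [eLpNorm_two_sq, enorm_sq_eq_sum]
  rw [lintegral_finsetSum' _ fun k _ =>
    ((locallyIntegrable_coord hG k).aestronglyMeasurable.enorm).pow_const 2]

theorem ae_tendsto_antisymmPart {u : Config d N → ℂ} (hanti : IsAntisymmetric u)
    {w : ℕ → Config d N → ℂ} (hw : ∀ᵐ x, Tendsto (fun n => w n x) atTop (𝓝 (u x)))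
    {i j : Fin N} (hij : i ≠ j) :
    ∀ᵐ x, Tendsto (fun n => antisymmPart i j (w n) x) atTop (𝓝 (u x)) := by
  have hS := measurePreserving_of_involutive (volume : Measure (Config d N)) _
    (reflect_reflect (relCoord_relDir hij) Finset.univ)
  filter_upwards [hw, hS.quasiMeasurePreserving.ae hw, hanti i j hij] with x h1 h2 h3
  simp only [reflect_relCoord hij] at h2
  have h4 := (h1.sub h2).div_const 2
  rwa [h3, sub_neg_eq_add, ← two_mul, mul_div_cancel_left₀ _ two_ne_zero] at h4

theorem sum_lintegral_le_liminf (hd : 1 ≤ d) {u : Config d N → ℂ}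
    (hu : AEStronglyMeasurable u volume) (hanti : IsAntisymmetric u)
    {w : ℕ → Config d N → ℂ} (hwc : ∀ n, Continuous (w n))
    (hw : ∀ᵐ x, Tendsto (fun n => w n x) atTop (𝓝 (u x))) :
    ∑ i : Fin N, ∑ j ∈ Finset.Ioi i, ∫⁻ x, ‖u x‖ₑ ^ 2 / ‖x i - x j‖ₑ ^ 2 ≤
      liminf (fun n => ∑ i : Fin N, ∑ j ∈ Finset.Ioi i,
        ∫⁻ x, ‖antisymmPart i j (w n) x‖ₑ ^ 2 / ‖x i - x j‖ₑ ^ 2) atTop := by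
  have hr : ∀ i j : Fin N, Measurable fun x : Config d N => ‖x i - x j‖ₑ ^ 2 := fun i j =>
    Continuous.measurable (by fun_prop)
  have hm : ∀ n (i j : Fin N), Measurable fun x : Config d N =>
      ‖antisymmPart i j (w n) x‖ₑ ^ 2 / ‖x i - x j‖ₑ ^ 2 := fun n i j => by
    refine Measurable.div ?_ (hr i j)
    have := hwc n
    refine (Continuous.measurable ?_).enorm.pow_const 2
    unfold antisymmPart
    fun_prop
  have hmu : ∀ i j : Fin N, AEMeasurable (fun x : Config d N =>
      ‖u x‖ₑ ^ 2 / ‖x i - x j‖ₑ ^ 2) volume := fun i j =>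
    (hu.enorm.pow_const 2).div (hr i j).aemeasurable
  have h1 : ∀ n, ∑ i : Fin N, ∑ j ∈ Finset.Ioi i,
      ∫⁻ x, ‖antisymmPart i j (w n) x‖ₑ ^ 2 / ‖x i - x j‖ₑ ^ 2 =
      ∫⁻ x, ∑ i : Fin N, ∑ j ∈ Finset.Ioi i,
        ‖antisymmPart i j (w n) x‖ₑ ^ 2 / ‖x i - x j‖ₑ ^ 2 := fun n => by
    rw [lintegral_finsetSum _ fun i _ => Finset.measurable_fun_sum _ fun j _ => hm n i j]
    exact Finset.sum_congr rfl fun i _ => (lintegral_finsetSum _ fun j _ => hm n i j).symm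
  have h2 : ∑ i : Fin N, ∑ j ∈ Finset.Ioi i, ∫⁻ x, ‖u x‖ₑ ^ 2 / ‖x i - x j‖ₑ ^ 2 =
      ∫⁻ x, ∑ i : Fin N, ∑ j ∈ Finset.Ioi i, ‖u x‖ₑ ^ 2 / ‖x i - x j‖ₑ ^ 2 := by
    rw [lintegral_finsetSum' _ fun i _ => Finset.aemeasurable_fun_sum _ fun j _ => hmu i j]
    exact Finset.sum_congr rfl fun i _ => (lintegral_finsetSum' _ fun j _ => hmu i j).symm
  simp only [h1, h2]
  refine le_trans (lintegral_mono_ae ?_) (lintegral_liminf_le fun n =>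
    Finset.measurable_fun_sum _ fun i _ => Finset.measurable_fun_sum _ fun j _ => hm n i j)
  have h3 : ∀ᵐ x : Config d N, ∀ i, ∀ j, i ≠ j →
      Tendsto (fun n => antisymmPart i j (w n) x) atTop (𝓝 (u x)) ∧ ‖x i - x j‖ₑ ^ 2 ≠ 0 := by
    simp only [ae_all_iff]
    exact fun i j hij => (ae_tendsto_antisymmPart hanti hw hij).and (ae_enorm_sub_ne_zero hd hij)
  -- Off the collision sets the denominators are nonzero, so division preserves the limit in `ℝ≥0∞`.
  filter_upwards [h3] with x hx
  refine le_of_eq (Tendsto.liminf_eq ?_).symm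
  refine tendsto_finsetSum _ fun i _ => tendsto_finsetSum _ fun j hj => ?_
  obtain ⟨hlim, h0⟩ := hx i j (Finset.mem_Ioi.1 hj).ne
  exact ENNReal.Tendsto.div_const (ENNReal.Tendsto.pow hlim.enorm) (Or.inr h0)

/-- The **many-particle Hardy inequality** for anti-symmetric functions in `H¹`. -/
theorem many_particle_hardy (hd : 1 ≤ d) (hN : 1 ≤ N)
    (u : Config d N → ℂ) (hu : MemH1 u)
    (hanti : IsAntisymmetric u)
    (G : Fin N → Config d N → EuclideanSpace ℂ (Fin d))
    (hG : HasWeakGradient u G) :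
    (d : ℝ≥0∞) ^ 2 / (N : ℝ≥0∞) *
        ∑ i : Fin N, ∑ j ∈ Finset.Ioi i, ∫⁻ x, ‖u x‖ₑ ^ 2 / ‖x i - x j‖ₑ ^ 2
      ≤ ∑ j : Fin N, ∫⁻ x, ‖G j x‖ₑ ^ 2 := by
  obtain ⟨w, C, hw1, hwc, hwu, hwG⟩ := exists_approximation volume hG.locallyIntegrable
  have hN0 : (N : ℝ≥0∞) ≠ 0 := by
    rw [Nat.cast_ne_zero]
    omega
  -- The cutoff error vanishes because `u` is in `L²`; no finiteness of the norms of `G` is needed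
  -- here.
  have hbound : Tendsto (fun n : ℕ => (N : ℝ≥0∞) * ∑ j : Fin N, ∑ k : Fin d,
      (eLpNorm (fun x => G j x k) 2 volume + ENNReal.ofReal
        (C * ‖(dir j k : Config d N)‖ * (1 / ((n : ℝ) + 1))) * eLpNorm u 2 volume) ^ 2) atTop
      (𝓝 ((N : ℝ≥0∞) * ∑ j : Fin N, ∑ k : Fin d, eLpNorm (fun x => G j x k) 2 volume ^ 2)) := by
    refine ENNReal.Tendsto.const_mul ?_ (Or.inr (by simp))
    refine tendsto_finsetSum _ fun j _ => tendsto_finsetSum _ fun k _ => ENNReal.Tendsto.pow ?_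
    have h0 := ENNReal.tendsto_ofReal ((tendsto_one_div_add_atTop_nhds_zero_nat (𝕜 := ℝ)).const_mul
      (C * ‖(dir j k : Config d N)‖))
    rw [mul_zero, ENNReal.ofReal_zero] at h0
    have h1 := ENNReal.Tendsto.mul_const h0 (Or.inr hu.1.eLpNorm_ne_top)
    simpa using h1.const_add (eLpNorm (fun x => G j x k) 2 volume)
  have hle : ∀ n, (d : ℝ≥0∞) ^ 2 * ∑ i : Fin N, ∑ j ∈ Finset.Ioi i,
      ∫⁻ x, ‖antisymmPart i j (w n) x‖ₑ ^ 2 / ‖x i - x j‖ₑ ^ 2 ≤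
      (N : ℝ≥0∞) * ∑ j : Fin N, ∑ k : Fin d,
      (eLpNorm (fun x => G j x k) 2 volume + ENNReal.ofReal
        (C * ‖(dir j k : Config d N)‖ * (1 / ((n : ℝ) + 1))) * eLpNorm u 2 volume) ^ 2 := fun n =>
    (many_particle_hardy_of_contDiff (hw1 n) (hwc n)).trans <|
      mul_le_mul_right (Finset.sum_le_sum fun j _ => Finset.sum_le_sum fun k _ =>
        pow_le_pow_left' (hwG n (dir j k) _ (locallyIntegrable_coord (hG.locallyIntegrable_grad j) k)
          (hasWeakDirDeriv_of_hasWeakGradient hG j k)) 2) _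
  have hmain : (d : ℝ≥0∞) ^ 2 * ∑ i : Fin N, ∑ j ∈ Finset.Ioi i,
      ∫⁻ x, ‖u x‖ₑ ^ 2 / ‖x i - x j‖ₑ ^ 2 ≤ N * ∑ j : Fin N, ∫⁻ x, ‖G j x‖ₑ ^ 2 := by
    simp only [← sum_eLpNorm_coord_sq (hG.locallyIntegrable_grad _)]
    rw [← hbound.liminf_eq]
    refine le_trans (mul_le_mul_right (sum_lintegral_le_liminf hd hu.1.aestronglyMeasurable hanti
      (fun n => (hw1 n).continuous) hwu) _) ?_
    rw [← ENNReal.liminf_const_mul_of_ne_top (by simp)]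
    exact liminf_le_liminf (Eventually.of_forall hle)
  rw [div_eq_mul_inv, mul_right_comm, ← div_eq_mul_inv]
  exact ENNReal.div_le_of_le_mul' hmain

end ManyParticle

theorem mainTheorem7 (d N : ℕ) (hd : 1 ≤ d) (hN : 1 ≤ N)
    (u : ManyParticle.Config d N → ℂ) (hu : ManyParticle.MemH1 u)
    (hanti : ManyParticle.IsAntisymmetric u)
    (G : Fin N → ManyParticle.Config d N → EuclideanSpace ℂ (Fin d))
    (hG : ManyParticle.HasWeakGradient u G) :
    (d : ℝ≥0∞) ^ 2 / (N : ℝ≥0∞) *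
        ∑ i : Fin N, ∑ j ∈ Finset.Ioi i, ∫⁻ x, ‖u x‖ₑ ^ 2 / ‖x i - x j‖ₑ ^ 2
      ≤ ∑ j : Fin N, ∫⁻ x, ‖G j x‖ₑ ^ 2 :=
  ManyParticle.many_particle_hardy hd hN u hu hanti G hG
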